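/- **Theorem (First-order optimality condition).** Let $n\ge 1$ and let $\Omega\subset\mathbb{R}^n$ be a bounded open set (in particular, $\Omega$ may be a bounded convex domain in $\mathbb{R}^2$ or $\mathbb{R}^3$ with $C^{1,1}$ or polygonal boundary). Let $a_{ij},c_0\in L^\infty(\Omega)$ ($1\le i,j\le n$) with $c_0\ge 0$ and $a_{ij}=a_{ji}$ a.e. in $\Omega$, and suppose that there is $\theta>0$ with $\sum_{i,j}a_{ij}(x)\xi_i\xi_j\ge\theta\|\xi\|^2$ for almost all $x\in\Omega$ and all $\xi\in\mathbb{R}^n$. Let $H^1_0(\Omega)$ be the closure of $C_c^\infty(\Omega)$ in $H^1(\Omega)$, and for $y,v\in H^1_0(\Omega)$ put $$a(y,v)=\int_\Omega\Big(\sum_{i,j=1}^n a_{ij}\,\partial_{x_i}y\,\partial_{x_j}v+c_0\,y\,v\Big)\,dx .$$ Let $y_c,y_d\in L^2(\Omega)$, $-\infty<a<0<b<+\infty$, $\alpha,\beta>0$, and $U_{ad}=\{v\in L^2(\Omega): a\le v\le b \text{ a.e. on }\Omega\}$. Consider the problem $$(\widetilde{\mathrm P})\quad \min_{(y,u,z)\in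 H^1_0(\Omega)\times L^2(\Omega)\times L^2(\Omega)} \tfrac12\|y-y_d\|_{L^2(\Omega)}^2+\tfrac{\alpha}{4}\|u\|_{L^2(\Omega)}^2+\tfrac{\alpha}{4}\|z\|_{L^2(\Omega)}^2+\beta\|z\|_{L^1(\Omega)}$$ subject to $a(y,v)=(u+y_c,v)_{L^2(\Omega)}$ for all $v\in H^1_0(\Omega)$, $u=z$, and $z\in U_{ad}$. Then $(y^*,u^*,z^*)\in H^1_0(\Omega)\times L^2(\Omega)\times L^2(\Omega)$ is an optimal solution of $(\widetilde{\mathrm P})$ if and only if there exist an adjoint state $p^*\in H^1_0(\Omega)$ and a multiplier $\lambda^*\in L^2(\Omega)$ such that 1. $a(y^*,v)=(u^*+y_c,v)_{L^2(\Omega)}$ for all $v\in H^1_0(\Omega)$ (state equation); 2. $a(v,p^*)=(y_d-y^*,v)_{L^2(\Omega)}$ for all $v\in H^1_0(\Omega)$ (adjoint equation); 3. $\frac{\alpha}{2}u^*-p^*+\lambda^*=0$; 4. $u^*=z^*$; 5. $z^*\in U_{ad}$; 6. $\big\langle\frac{\alpha}{2}z^*-\lambda^*,\tilde z-z^*\big\rangle_{L^2(\Omega)}+\beta\big(\|\tilde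 z\|_{L^1(\Omega)}-\|z^*\|_{L^1(\Omega)}\big)\ge 0$ for all $\tilde z\in U_{ad}$. Moreover, whenever 1–6 hold, $$u^*(x)=\Pi_{U_{ad}}\Big(\tfrac1\alpha\,\mathrm{soft}(p^*(x),\beta)\Big)\quad\text{for a.e. }x\in\Omega,$$ where $\Pi_{U_{ad}}(t)=\max\{a,\min\{t,b\}\}$ and $\mathrm{soft}(t,\beta)=\mathrm{sgn}(t)\max(|t|-\beta,0)$. In addition, the optimal control has the regularity $u^*\in H^1(\Omega)$. -/

import Mathlib

noncomputable section

open MeasureTheory TopologicalSpace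
open scoped Distributions ENNReal

namespace SparseControl

/-- The Lebesgue measure on the open set `Ω ⊆ ℝⁿ`. -/
abbrev vol {n : ℕ} (Ω : Opens (EuclideanSpace ℝ (Fin n))) :
    Measure (EuclideanSpace ℝ (Fin n)) :=
  volume.restrict (Ω : Set (EuclideanSpace ℝ (Fin n)))

/-- `L²(Ω)`, real valued. -/
abbrev L2 {n : ℕ} (Ω : Opens (EuclideanSpace ℝ (Fin n))) : Type :=
  Lp ℝ 2 (vol Ω)

/-- Pairs of a function in `L²(Ω)` and a vector field in `L²(Ω)ⁿ`, with the Hilbert norm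
`(‖y‖² + ∑ᵢ ‖gᵢ‖²)^(1/2)`. -/
abbrev Jet {n : ℕ} (Ω : Opens (EuclideanSpace ℝ (Fin n))) : Type :=
  WithLp 2 (L2 Ω × PiLp 2 (fun _ : Fin n => L2 Ω))

/-- The classical partial derivative `∂φ/∂xᵢ` of a test function `φ ∈ C_c^∞(Ω)`. -/
def partialDeriv {n : ℕ} {Ω : Opens (EuclideanSpace ℝ (Fin n))} (φ : 𝓓(Ω, ℝ)) (i : Fin n)
    (x : EuclideanSpace ℝ (Fin n)) : ℝ :=
  fderiv ℝ φ x (EuclideanSpace.single i 1)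

theorem memLp_testFunction {n : ℕ} {Ω : Opens (EuclideanSpace ℝ (Fin n))} (φ : 𝓓(Ω, ℝ)) :
    MemLp φ 2 (vol Ω) :=
  (φ.continuous.memLp_of_hasCompactSupport φ.hasCompactSupport).restrict _

theorem memLp_partialDeriv {n : ℕ} {Ω : Opens (EuclideanSpace ℝ (Fin n))} (φ : 𝓓(Ω, ℝ))
    (i : Fin n) : MemLp (partialDeriv φ i) 2 (vol Ω) := by
  have hc : Continuous (partialDeriv φ i) :=
    (φ.contDiff.continuous_fderiv (by simp)).clm_apply continuous_const
  have hs : HasCompactSupport (partialDeriv φ i) :=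
    φ.hasCompactSupport.fderiv_apply (𝕜 := ℝ) _
  exact (hc.memLp_of_hasCompactSupport hs).restrict _

theorem integrable_mul_of_memLp {n : ℕ} {Ω : Opens (EuclideanSpace ℝ (Fin n))}
    {f g : EuclideanSpace ℝ (Fin n) → ℝ} (hf : MemLp f 2 (vol Ω)) (hg : MemLp g 2 (vol Ω)) :
    Integrable (fun x => f x * g x) (vol Ω) :=
  hf.integrable_mul hg

/-- `g` is the weak gradient of `y` on `Ω`:
`∫_Ω y ∂ᵢφ = - ∫_Ω gᵢ φ` for all `φ ∈ C_c^∞(Ω)` and all `i`. -/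
def IsWeakGradient {n : ℕ} {Ω : Opens (EuclideanSpace ℝ (Fin n))} (y : L2 Ω)
    (g : Fin n → L2 Ω) : Prop :=
  ∀ (φ : 𝓓(Ω, ℝ)) (i : Fin n),
    ∫ x, y x * partialDeriv φ i x ∂(vol Ω) = - ∫ x, g i x * φ x ∂(vol Ω)

/-- The Sobolev space `H¹(Ω)`. An element is stored together with its weak gradient, which is
uniquely determined (see `isWeakGradient_unique`); the norm inherited from `Jet Ω` is the
`H¹`-norm. -/
def H1 {n : ℕ} (Ω : Opens (EuclideanSpace ℝ (Fin n))) : Submodule ℝ (Jet Ω) where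
  carrier := {w | IsWeakGradient w.fst w.snd}
  add_mem' := by
    intro v w hv hw φ i
    have e1 : ∫ x, (v + w).fst x * partialDeriv φ i x ∂(vol Ω)
        = ∫ x, (v.fst x * partialDeriv φ i x + w.fst x * partialDeriv φ i x) ∂(vol Ω) := by
      refine integral_congr_ae ?_
      filter_upwards [Lp.coeFn_add v.fst w.fst] with x hx
      rw [WithLp.add_fst, hx, Pi.add_apply, add_mul]
    have e2 : ∫ x, (v + w).snd i x * φ x ∂(vol Ω)
        = ∫ x, (v.snd i x * φ x + w.snd i x * φ x) ∂(vol Ω) := by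
      refine integral_congr_ae ?_
      filter_upwards [Lp.coeFn_add (v.snd i) (w.snd i)] with x hx
      rw [WithLp.add_snd, PiLp.add_apply, hx, Pi.add_apply, add_mul]
    rw [e1, e2, integral_add (integrable_mul_of_memLp (Lp.memLp v.fst) (memLp_partialDeriv φ i))
        (integrable_mul_of_memLp (Lp.memLp w.fst) (memLp_partialDeriv φ i)),
      integral_add (integrable_mul_of_memLp (Lp.memLp (v.snd i)) (memLp_testFunction φ))
        (integrable_mul_of_memLp (Lp.memLp (w.snd i)) (memLp_testFunction φ)), hv φ i, hw φ i]
    ring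
  zero_mem' := by
    intro φ i
    have e1 : ∫ x, (0 : Jet Ω).fst x * partialDeriv φ i x ∂(vol Ω) = 0 := by
      refine integral_eq_zero_of_ae ?_
      filter_upwards [Lp.coeFn_zero ℝ 2 (vol Ω)] with x hx
      rw [WithLp.zero_fst, hx, Pi.zero_apply, zero_mul]
    have e2 : ∫ x, (0 : Jet Ω).snd i x * φ x ∂(vol Ω) = 0 := by
      refine integral_eq_zero_of_ae ?_
      filter_upwards [Lp.coeFn_zero ℝ 2 (vol Ω)] with x hx
      rw [WithLp.zero_snd, PiLp.zero_apply, hx, Pi.zero_apply, zero_mul]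
    rw [e1, e2, neg_zero]
  smul_mem' := by
    intro c w hw φ i
    have e1 : ∫ x, (c • w).fst x * partialDeriv φ i x ∂(vol Ω)
        = ∫ x, c * (w.fst x * partialDeriv φ i x) ∂(vol Ω) := by
      refine integral_congr_ae ?_
      filter_upwards [Lp.coeFn_smul c w.fst] with x hx
      rw [WithLp.smul_fst, hx, Pi.smul_apply, smul_eq_mul, mul_assoc]
    have e2 : ∫ x, (c • w).snd i x * φ x ∂(vol Ω)
        = ∫ x, c * (w.snd i x * φ x) ∂(vol Ω) := by
      refine integral_congr_ae ?_
      filter_upwards [Lp.coeFn_smul c (w.snd i)] with x hx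
      rw [WithLp.smul_snd, PiLp.smul_apply, hx, Pi.smul_apply, smul_eq_mul, mul_assoc]
    rw [e1, e2, integral_const_mul, integral_const_mul, hw φ i]
    ring

/-- Weak gradients are unique, so that the first component of an element of `H1 Ω`
determines the element. -/
theorem isWeakGradient_unique {n : ℕ} {Ω : Opens (EuclideanSpace ℝ (Fin n))} {y : L2 Ω}
    {g h : Fin n → L2 Ω} (hg : IsWeakGradient y g) (hh : IsWeakGradient y h) : g = h := by
  funext i
  have hint : ∀ f : L2 Ω, LocallyIntegrableOn f (Ω : Set (EuclideanSpace ℝ (Fin n))) volume :=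
    fun f => (locallyIntegrableOn_of_locallyIntegrable_restrict
      ((Lp.memLp f).locallyIntegrable (by norm_num)))
  have key : ∀ᵐ x ∂volume, x ∈ (Ω : Set (EuclideanSpace ℝ (Fin n))) → g i x - h i x = 0 := by
    refine Ω.isOpen.ae_eq_zero_of_integral_contDiff_smul_eq_zero
      (f := fun x => g i x - h i x) ((hint (g i)).sub (hint (h i))) ?_
    intro ψ hψ hψc hψs
    let φ : 𝓓(Ω, ℝ) := ⟨ψ, hψ, hψc, hψs⟩
    have h0 : ∫ x, g i x * φ x ∂(vol Ω) = ∫ x, h i x * φ x ∂(vol Ω) :=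
      neg_injective ((hg φ i).symm.trans (hh φ i))
    have h1 : ∫ x, ψ x • (g i x - h i x) ∂(vol Ω) = 0 := by
      have : ∀ x, ψ x • (g i x - h i x) = g i x * φ x - h i x * φ x := by
        intro x
        change ψ x * _ = g i x * ψ x - h i x * ψ x
        ring
      simp_rw [this]
      rw [integral_sub (integrable_mul_of_memLp (Lp.memLp (g i)) (memLp_testFunction φ))
        (integrable_mul_of_memLp (Lp.memLp (h i)) (memLp_testFunction φ)), h0, sub_self]
    rw [← h1]
    refine (setIntegral_eq_integral_of_forall_compl_eq_zero ?_).symm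
    intro x hx
    have : ψ x = 0 := image_eq_zero_of_notMem_tsupport (fun hx' => hx (hψs hx'))
    rw [this, zero_smul]
  refine Lp.ext ?_
  rw [Filter.EventuallyEq, ae_restrict_iff' Ω.isOpen.measurableSet]
  filter_upwards [key] with x hx hxΩ
  exact sub_eq_zero.mp (hx hxΩ)

/-- The element `(φ, ∇φ)` of `Jet Ω` given by a test function `φ ∈ C_c^∞(Ω)`. -/
def testJet {n : ℕ} {Ω : Opens (EuclideanSpace ℝ (Fin n))} (φ : 𝓓(Ω, ℝ)) : Jet Ω :=
  WithLp.toLp 2 ((memLp_testFunction φ).toLp φ,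
    WithLp.toLp 2 fun i => (memLp_partialDeriv φ i).toLp (partialDeriv φ i))

/-- The Sobolev space `H¹₀(Ω)`: the closure of `C_c^∞(Ω)` in `H¹(Ω)`. -/
def H10 {n : ℕ} (Ω : Opens (EuclideanSpace ℝ (Fin n))) : Submodule ℝ (Jet Ω) :=
  H1 Ω ⊓ (Submodule.span ℝ (Set.range (testJet (Ω := Ω)))).topologicalClosure

/-- The function in `L²(Ω)` underlying an element of `H¹₀(Ω)`. -/
def H10.val {n : ℕ} {Ω : Opens (EuclideanSpace ℝ (Fin n))} (y : H10 Ω) : L2 Ω :=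
  (y : Jet Ω).fst

/-- The weak partial derivative `∂y/∂xᵢ` of an element of `H¹₀(Ω)`. -/
def H10.deriv {n : ℕ} {Ω : Opens (EuclideanSpace ℝ (Fin n))} (y : H10 Ω) (i : Fin n) : L2 Ω :=
  (y : Jet Ω).snd i

/-- The function `u ∈ L²(Ω)` belongs to `H¹(Ω)`. -/
def MemH1 {n : ℕ} {Ω : Opens (EuclideanSpace ℝ (Fin n))} (u : L2 Ω) : Prop :=
  ∃ w ∈ H1 Ω, w.fst = u

/-- The assumptions on the coefficients of `A y = - ∑ᵢⱼ ∂ⱼ(aᵢⱼ ∂ᵢ y) + c₀ y`. -/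
structure UniformlyElliptic {n : ℕ} (Ω : Opens (EuclideanSpace ℝ (Fin n)))
    (A : EuclideanSpace ℝ (Fin n) → Matrix (Fin n) (Fin n) ℝ)
    (c₀ : EuclideanSpace ℝ (Fin n) → ℝ) : Prop where
  memLp_matrix : ∀ i j, MemLp (fun x => A x i j) ∞ (vol Ω)
  memLp_potential : MemLp c₀ ∞ (vol Ω)
  potential_nonneg : ∀ᵐ x ∂(vol Ω), 0 ≤ c₀ x
  symmetric : ∀ᵐ x ∂(vol Ω), ∀ i j, A x i j = A x j i
  coercive : ∃ θ : ℝ, 0 < θ ∧ ∀ᵐ x ∂(vol Ω), ∀ ξ : EuclideanSpace ℝ (Fin n),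
    θ * ‖ξ‖ ^ 2 ≤ ∑ i, ∑ j, A x i j * ξ i * ξ j

/-- The bilinear form `a(y,v) = ∫_Ω (∑ᵢⱼ aᵢⱼ ∂ᵢy ∂ⱼv + c₀ y v) dx` on `H¹₀(Ω)`. -/
def bilinForm {n : ℕ} {Ω : Opens (EuclideanSpace ℝ (Fin n))}
    (A : EuclideanSpace ℝ (Fin n) → Matrix (Fin n) (Fin n) ℝ)
    (c₀ : EuclideanSpace ℝ (Fin n) → ℝ) (y v : H10 Ω) : ℝ :=
  ∫ x, ((∑ i, ∑ j, A x i j * H10.deriv y i x * H10.deriv v j x)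
    + c₀ x * H10.val y x * H10.val v x) ∂(vol Ω)

/-- `y = 𝒮 f`: `y ∈ H¹₀(Ω)` is the weak solution of `A y = f` in `Ω`, `y = 0` on `∂Ω`. -/
def IsWeakSolution {n : ℕ} {Ω : Opens (EuclideanSpace ℝ (Fin n))}
    (A : EuclideanSpace ℝ (Fin n) → Matrix (Fin n) (Fin n) ℝ)
    (c₀ : EuclideanSpace ℝ (Fin n) → ℝ) (y : H10 Ω) (f : L2 Ω) : Prop :=
  ∀ v : H10 Ω, bilinForm A c₀ y v = inner ℝ f (H10.val v)

/-- `p = 𝒮* f`: `p ∈ H¹₀(Ω)` is the weak solution of the adjoint equation `A* p = f` in `Ω`,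
`p = 0` on `∂Ω`. -/
def IsAdjointSolution {n : ℕ} {Ω : Opens (EuclideanSpace ℝ (Fin n))}
    (A : EuclideanSpace ℝ (Fin n) → Matrix (Fin n) (Fin n) ℝ)
    (c₀ : EuclideanSpace ℝ (Fin n) → ℝ) (p : H10 Ω) (f : L2 Ω) : Prop :=
  ∀ v : H10 Ω, bilinForm A c₀ v p = inner ℝ f (H10.val v)

/-- The admissible set `U_ad = {v ∈ L²(Ω) : a ≤ v ≤ b a.e. on Ω}`. -/
def Uad {n : ℕ} (Ω : Opens (EuclideanSpace ℝ (Fin n))) (a b : ℝ) : Set (L2 Ω) :=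
  {v | ∀ᵐ x ∂(vol Ω), a ≤ v x ∧ v x ≤ b}

/-- The norm of `L¹(Ω)` on `L²(Ω)` (finite, for `Ω` bounded). -/
def normL1 {n : ℕ} {Ω : Opens (EuclideanSpace ℝ (Fin n))} (v : L2 Ω) : ℝ :=
  ∫ x, |v x| ∂(vol Ω)

/-- The cost functional
`J(y,u,z) = ½‖y - y_d‖² + (α/4)‖u‖² + (α/4)‖z‖² + β‖z‖_{L¹}`. -/
def cost {n : ℕ} {Ω : Opens (EuclideanSpace ℝ (Fin n))} (yd : L2 Ω) (α β : ℝ)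
    (w : H10 Ω × L2 Ω × L2 Ω) : ℝ :=
  1 / 2 * ‖H10.val w.1 - yd‖ ^ 2 + α / 4 * ‖w.2.1‖ ^ 2 + α / 4 * ‖w.2.2‖ ^ 2
    + β * normL1 w.2.2

/-- The feasible triples `(y,u,z) ∈ H¹₀(Ω) × L²(Ω) × L²(Ω)`:
`A y = u + y_c` weakly, `u = z`, `z ∈ U_ad`. -/
def feasible {n : ℕ} {Ω : Opens (EuclideanSpace ℝ (Fin n))}
    (A : EuclideanSpace ℝ (Fin n) → Matrix (Fin n) (Fin n) ℝ)
    (c₀ : EuclideanSpace ℝ (Fin n) → ℝ) (yc : L2 Ω) (a b : ℝ) :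
    Set (H10 Ω × L2 Ω × L2 Ω) :=
  {w | IsWeakSolution A c₀ w.1 (w.2.1 + yc) ∧ w.2.1 = w.2.2 ∧ w.2.2 ∈ Uad Ω a b}

/-- `(y,u,z)` is an optimal solution of the control problem. -/
def IsOptimal {n : ℕ} {Ω : Opens (EuclideanSpace ℝ (Fin n))}
    (A : EuclideanSpace ℝ (Fin n) → Matrix (Fin n) (Fin n) ℝ)
    (c₀ : EuclideanSpace ℝ (Fin n) → ℝ) (yc yd : L2 Ω) (a b α β : ℝ)
    (y : H10 Ω) (u z : L2 Ω) : Prop :=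
  (y, u, z) ∈ feasible A c₀ yc a b ∧
    IsMinOn (cost yd α β) (feasible A c₀ yc a b) (y, u, z)

/-- The KKT system with adjoint state `p` and multiplier `lam`. -/
structure KKT {n : ℕ} {Ω : Opens (EuclideanSpace ℝ (Fin n))}
    (A : EuclideanSpace ℝ (Fin n) → Matrix (Fin n) (Fin n) ℝ)
    (c₀ : EuclideanSpace ℝ (Fin n) → ℝ) (yc yd : L2 Ω) (a b α β : ℝ)
    (y : H10 Ω) (u z : L2 Ω) (p : H10 Ω) (lam : L2 Ω) : Prop where
  state : IsWeakSolution A c₀ y (u + yc)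
  adjoint : IsAdjointSolution A c₀ p (yd - H10.val y)
  stationarity : (α / 2) • u - H10.val p + lam = 0
  control_eq : u = z
  admissible : z ∈ Uad Ω a b
  variational : ∀ zt ∈ Uad Ω a b,
    0 ≤ inner ℝ ((α / 2) • z - lam) (zt - z) + β * (normL1 zt - normL1 z)

/-- Soft thresholding `soft(t,β) = sgn(t) max(|t| - β, 0)`. -/
def soft (t β : ℝ) : ℝ :=
  Real.sign t * max (|t| - β) 0

/-- The pointwise projection onto `[a,b]`. -/
def proj (a b t : ℝ) : ℝ :=
  max a (min t b)

end SparseControl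

end

/-! With `u = z` eliminated, the problem is convex: the cost is a quadratic plus `β` times the L¹
norm, and the state depends affinely on the control. First-order conditions are therefore necessary
and sufficient. The quadratic part is expanded exactly about the candidate. The remainder is a sum
of squares, and the adjoint equation (`IsAdjointSolution.inner_sub_eq`) turns the linear term in the
state into `-⟨p, u' - u⟩`. Sufficiency (`KKT.isOptimal`) drops the squares. Necessity
(`IsOptimal.exists_KKT`) moves a fraction `t` along a segment in the feasible set, bounds the L¹
norm by convexity and lets `t` be small. It needs states and adjoints to exist, which Lax–Milgram
provides through ellipticity and `poincare`.

The variational inequality says that `u` minimizes `α/2 t² - p t + β |t|` over `[a, b]` pointwise.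
This scalar problem is solved by `F(p)`, where `F` is soft thresholding, scaling by `1/α` and
projection (`proj_soft_variational`); strong monotonicity in L² gives `u = F(p)`.

Since `F` is Lipschitz and `F 0 = 0`, regularity of `u` follows from `memH1_compLp`: the functional
`ψ ↦ ∫ F(p) ∂ᵢψ` is bounded in the L² norm of `ψ`, so Riesz produces the weak derivative without a
chain rule for `F`. -/

noncomputable section

open MeasureTheory TopologicalSpace
open scoped Distributions ENNReal

namespace SparseControl

/-! ### Bounded forms on H¹₀, completeness and density of test functions. -/

section BilinearForm

variable {n : ℕ} {Ω : Opens (EuclideanSpace ℝ (Fin n))}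

theorem inner_eq_integral (f g : L2 Ω) : inner ℝ f g = ∫ x, f x * g x ∂(vol Ω) := by
  rw [L2.inner_def]
  simp [mul_comm]

theorem inner_toLp_right (f : L2 Ω) {g : EuclideanSpace ℝ (Fin n) → ℝ} (hg : MemLp g 2 (vol Ω)) :
    inner ℝ f (hg.toLp g) = ∫ x, f x * g x ∂(vol Ω) := by
  rw [inner_eq_integral]
  refine integral_congr_ae ?_
  filter_upwards [hg.coeFn_toLp] with x hx
  rw [hx]

theorem integral_sq_eq (f : L2 Ω) : ∫ x, f x ^ 2 ∂(vol Ω) = ‖f‖ ^ 2 := by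
  rw [← real_inner_self_eq_norm_sq, inner_eq_integral]
  simp only [sq]

theorem integrable_weighted {g : EuclideanSpace ℝ (Fin n) → ℝ} (hg : MemLp g ∞ (vol Ω))
    (f h : L2 Ω) : Integrable (fun x => g x * f x * h x) (vol Ω) :=
  integrable_mul_of_memLp ((Lp.memLp f).mul' hg) (Lp.memLp h)

/-- The bounded bilinear form `(f, h) ↦ ∫_Ω g f h` on `L²(Ω)` with weight `g ∈ L^∞(Ω)`. -/
def weightedForm {g : EuclideanSpace ℝ (Fin n) → ℝ} (hg : MemLp g ∞ (vol Ω)) :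
    L2 Ω →L[ℝ] L2 Ω →L[ℝ] ℝ :=
  LinearMap.mkContinuous₂
    (LinearMap.mk₂ ℝ (fun f h => ∫ x, g x * f x * h x ∂(vol Ω))
      (fun f f' h => by
        rw [← integral_add (integrable_weighted hg f h) (integrable_weighted hg f' h)]
        refine integral_congr_ae ?_
        filter_upwards [Lp.coeFn_add f f'] with x hx
        rw [hx, Pi.add_apply]
        ring)
      (fun c f h => by
        rw [smul_eq_mul, ← integral_const_mul]
        refine integral_congr_ae ?_
        filter_upwards [Lp.coeFn_smul c f] with x hx
        rw [hx, Pi.smul_apply, smul_eq_mul]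
        ring)
      (fun f h h' => by
        rw [← integral_add (integrable_weighted hg f h) (integrable_weighted hg f h')]
        refine integral_congr_ae ?_
        filter_upwards [Lp.coeFn_add h h'] with x hx
        rw [hx, Pi.add_apply]
        ring)
      (fun c f h => by
        rw [smul_eq_mul, ← integral_const_mul]
        refine integral_congr_ae ?_
        filter_upwards [Lp.coeFn_smul c h] with x hx
        rw [hx, Pi.smul_apply, smul_eq_mul]
        ring))
    (lpNorm g ∞ (vol Ω))
    (fun f h => by
      change ‖∫ x, g x * f x * h x ∂(vol Ω)‖ ≤ _
      have e : ∫ x, g x * f x * h x ∂(vol Ω)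
          = inner ℝ (((Lp.memLp f).mul' hg).toLp (fun x => g x * f x)) h := by
        rw [real_inner_comm, inner_toLp_right]
        exact integral_congr_ae (.of_forall fun x => mul_comm _ _)
      rw [e]
      refine (norm_inner_le_norm _ _).trans ?_
      gcongr
      refine Lp.norm_le_mul_norm_of_ae_le_mul ?_
      filter_upwards [MemLp.coeFn_toLp (p := 2) ((Lp.memLp f).mul' hg),
        ae_le_lpNorm_exponent_top hg] with x hx hb
      rw [hx, norm_mul]
      gcongr)

theorem weightedForm_apply {g : EuclideanSpace ℝ (Fin n) → ℝ} (hg : MemLp g ∞ (vol Ω))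
    (f h : L2 Ω) : weightedForm hg f h = ∫ x, g x * f x * h x ∂(vol Ω) :=
  rfl

/-- The inclusion of `H¹₀(Ω)` into `L²(Ω)`. -/
def H10.valL : H10 Ω →L[ℝ] L2 Ω :=
  (WithLp.fstL 2 ℝ (L2 Ω) (PiLp 2 fun _ : Fin n => L2 Ω)).comp (H10 Ω).subtypeL

/-- The weak partial derivative as a bounded operator from `H¹₀(Ω)` to `L²(Ω)`. -/
def H10.derivL (i : Fin n) : H10 Ω →L[ℝ] L2 Ω :=
  ((PiLp.proj 2 (fun _ : Fin n => L2 Ω) i).comp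
    (WithLp.sndL 2 ℝ (L2 Ω) (PiLp 2 fun _ : Fin n => L2 Ω))).comp (H10 Ω).subtypeL

theorem H10.valL_apply (y : H10 Ω) : H10.valL y = H10.val y := rfl

theorem H10.derivL_apply (i : Fin n) (y : H10 Ω) : H10.derivL i y = H10.deriv y i := rfl

theorem H10.norm_sq (y : H10 Ω) :
    ‖y‖ ^ 2 = ‖H10.val y‖ ^ 2 + ∑ i, ‖H10.deriv y i‖ ^ 2 := by
  change ‖(y : Jet Ω)‖ ^ 2 = _
  rw [WithLp.prod_norm_sq_eq_of_L2, PiLp.norm_sq_eq_of_L2]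
  rfl

variable {A : EuclideanSpace ℝ (Fin n) → Matrix (Fin n) (Fin n) ℝ}
  {c₀ : EuclideanSpace ℝ (Fin n) → ℝ}

/-- `bilinForm A c₀` as a bounded bilinear form on `H¹₀(Ω)`. -/
def bilinL (hA : UniformlyElliptic Ω A c₀) : H10 Ω →L[ℝ] H10 Ω →L[ℝ] ℝ :=
  (∑ i, ∑ j, (weightedForm (hA.memLp_matrix i j)).bilinearComp (H10.derivL i) (H10.derivL j))
    + (weightedForm hA.memLp_potential).bilinearComp H10.valL H10.valL

theorem bilinL_apply (hA : UniformlyElliptic Ω A c₀) (y v : H10 Ω) :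
    bilinL hA y v = bilinForm A c₀ y v := by
  have h1 : ∀ i j, Integrable (fun x => A x i j * H10.deriv y i x * H10.deriv v j x) (vol Ω) :=
    fun i j => integrable_weighted (hA.memLp_matrix i j) _ _
  rw [bilinForm, integral_add
    (integrable_finsetSum _ fun i _ => integrable_finsetSum _ fun j _ => h1 i j)
    (integrable_weighted hA.memLp_potential _ _),
    integral_finsetSum _ fun i _ => integrable_finsetSum _ fun j _ => h1 i j]
  simp_rw [integral_finsetSum _ fun j _ => h1 _ j]
  simp [bilinL, weightedForm_apply, H10.valL_apply, H10.derivL_apply]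

theorem bilinForm_comm (hA : UniformlyElliptic Ω A c₀) (y v : H10 Ω) :
    bilinForm A c₀ y v = bilinForm A c₀ v y := by
  refine integral_congr_ae ?_
  filter_upwards [hA.symmetric] with x hx
  rw [Finset.sum_comm]
  congr 1
  · refine Finset.sum_congr rfl fun i _ => Finset.sum_congr rfl fun j _ => ?_
    rw [hx j i]
    ring
  · ring

/-- Only the gradient is controlled, because `c₀` may vanish; the L² part of the norm is left to the
Poincaré inequality. -/
theorem exists_le_bilinForm_self (hA : UniformlyElliptic Ω A c₀) :
    ∃ θ : ℝ, 0 < θ ∧ ∀ y : H10 Ω, θ * ∑ i, ‖H10.deriv y i‖ ^ 2 ≤ bilinForm A c₀ y y := by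
  obtain ⟨θ, hθ, h⟩ := hA.coercive
  refine ⟨θ, hθ, fun y => ?_⟩
  have hsq : ∀ i, Integrable (fun x => H10.deriv y i x ^ 2) (vol Ω) := fun i =>
    (Lp.memLp _).integrable_sq
  simp_rw [← integral_sq_eq]
  rw [← integral_finsetSum _ fun i _ => hsq i, ← integral_const_mul]
  refine integral_mono_ae ((integrable_finsetSum _ fun i _ => hsq i).const_mul θ) ?_ ?_
  · exact (integrable_finsetSum _ fun i _ => integrable_finsetSum _ fun j _ =>
      integrable_weighted (hA.memLp_matrix i j) _ _).add
      (integrable_weighted hA.memLp_potential _ _)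
  · filter_upwards [h, hA.potential_nonneg] with x hx hc
    have := hx (WithLp.toLp 2 fun i => H10.deriv y i x)
    rw [EuclideanSpace.norm_sq_eq] at this
    simp only [Real.norm_eq_abs, sq_abs] at this
    have h2 : 0 ≤ c₀ x * H10.val y x * H10.val y x := by
      rw [mul_assoc]
      exact mul_nonneg hc (mul_self_nonneg _)
    exact this.trans (le_add_of_nonneg_right h2)

theorem testJet_add (φ ψ : 𝓓(Ω, ℝ)) : testJet (φ + ψ) = testJet φ + testJet ψ := by
  have hd : ∀ i, partialDeriv (φ + ψ) i = partialDeriv φ i + partialDeriv ψ i := by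
    intro i
    funext x
    have : fderiv ℝ (⇑(φ + ψ)) x = fderiv ℝ φ x + fderiv ℝ ψ x := by
      rw [FunLike.coe_add]
      exact fderiv_add (φ.contDiff.differentiable (by simp) x)
        (ψ.contDiff.differentiable (by simp) x)
    rw [partialDeriv, this]
    rfl
  refine WithLp.ofLp_injective 2 (Prod.ext ?_ (WithLp.ofLp_injective 2 (funext fun i => ?_)))
  · exact MemLp.toLp_add (memLp_testFunction φ) (memLp_testFunction ψ)
  · exact (MemLp.toLp_congr (memLp_partialDeriv (φ + ψ) i)
      ((memLp_partialDeriv φ i).add (memLp_partialDeriv ψ i))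
      (.of_forall fun x => congrFun (hd i) x)).trans
      (MemLp.toLp_add (memLp_partialDeriv φ i) (memLp_partialDeriv ψ i))

theorem testJet_smul (c : ℝ) (φ : 𝓓(Ω, ℝ)) : testJet (c • φ) = c • testJet φ := by
  have hd : ∀ i, partialDeriv (c • φ) i = c • partialDeriv φ i := by
    intro i
    funext x
    have : fderiv ℝ (⇑(c • φ)) x = c • fderiv ℝ φ x := by
      rw [FunLike.coe_smul]
      exact fderiv_const_smul (φ.contDiff.differentiable (by simp) x) c
    rw [partialDeriv, this]
    rfl
  refine WithLp.ofLp_injective 2 (Prod.ext ?_ (WithLp.ofLp_injective 2 (funext fun i => ?_)))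
  · exact MemLp.toLp_const_smul c (memLp_testFunction φ)
  · exact (MemLp.toLp_congr (memLp_partialDeriv (c • φ) i) ((memLp_partialDeriv φ i).const_smul c)
      (.of_forall fun x => congrFun (hd i) x)).trans
      (MemLp.toLp_const_smul c (memLp_partialDeriv φ i))

/-- `φ ↦ (φ, ∇φ)` as a linear map on test functions. -/
def testJetₗ : 𝓓(Ω, ℝ) →ₗ[ℝ] Jet Ω where
  toFun := testJet
  map_add' := testJet_add
  map_smul' := testJet_smul

/-- Density principle: an inequality between continuous functions of the jet need only be checked on
test functions. -/
theorem H10.mem_of_isClosed (y : H10 Ω) {s : Set (Jet Ω)} (hs : IsClosed s)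
    (h : ∀ φ : 𝓓(Ω, ℝ), testJet φ ∈ s) : (y : Jet Ω) ∈ s := by
  have h1 : (y : Jet Ω) ∈ (Submodule.span ℝ (Set.range (testJet (Ω := Ω)))).topologicalClosure :=
    y.2.2
  -- By linearity of `testJet` its range is already a subspace, so the span adds nothing.
  have h2 : Submodule.span ℝ (Set.range (testJet (Ω := Ω))) = LinearMap.range testJetₗ :=
    Submodule.span_eq (LinearMap.range (testJetₗ (Ω := Ω)))
  rw [h2, ← SetLike.mem_coe, Submodule.topologicalClosure_coe] at h1
  refine closure_minimal ?_ hs h1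
  rintro _ ⟨φ, rfl⟩
  exact h φ

/-- Each weak-derivative identity equates two continuous functionals of the jet. This yields the
completeness of H¹₀ that Lax–Milgram requires. -/
theorem isClosed_H1 : IsClosed (H1 Ω : Set (Jet Ω)) := by
  have : (H1 Ω : Set (Jet Ω)) = ⋂ (φ : 𝓓(Ω, ℝ)) (i : Fin n),
      {w | inner ℝ w.fst ((memLp_partialDeriv φ i).toLp (partialDeriv φ i))
        = - inner ℝ (w.snd i) ((memLp_testFunction φ).toLp φ)} := by
    ext w
    simp only [Set.mem_iInter, Set.mem_ofPred_eq, inner_toLp_right]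
    rfl
  rw [this]
  refine isClosed_iInter fun φ => isClosed_iInter fun i => isClosed_eq ?_ ?_ <;> fun_prop

instance : CompleteSpace (H10 Ω) :=
  (isClosed_H1.inter (Submodule.isClosed_topologicalClosure _)).completeSpace_coe

end BilinearForm

/-! ### The Poincaré inequality. -/

section Sobolev

variable {n : ℕ} {Ω : Opens (EuclideanSpace ℝ (Fin n))}

theorem testFunction_eq_zero (φ : 𝓓(Ω, ℝ)) {x : EuclideanSpace ℝ (Fin n)}
    (hx : x ∉ (Ω : Set (EuclideanSpace ℝ (Fin n)))) : φ x = 0 :=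
  image_eq_zero_of_notMem_tsupport fun h => hx (φ.tsupport_subset h)

theorem partialDeriv_eq_zero (φ : 𝓓(Ω, ℝ)) (i : Fin n) {x : EuclideanSpace ℝ (Fin n)}
    (hx : x ∉ (Ω : Set (EuclideanSpace ℝ (Fin n)))) : partialDeriv φ i x = 0 := by
  rw [partialDeriv, image_eq_zero_of_notMem_tsupport
    fun h => hx (φ.tsupport_subset (tsupport_fderiv_subset ℝ h))]
  rfl

theorem continuous_partialDeriv (φ : 𝓓(Ω, ℝ)) (i : Fin n) : Continuous (partialDeriv φ i) :=
  (φ.contDiff.continuous_fderiv (by simp)).clm_apply continuous_const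

theorem integrable_coord_mul (φ : 𝓓(Ω, ℝ)) (i : Fin n) :
    Integrable (fun x : EuclideanSpace ℝ (Fin n) => x i * (2 * φ x * partialDeriv φ i x))
      volume := by
  have hxc : Continuous fun x : EuclideanSpace ℝ (Fin n) => x i := by fun_prop
  refine (hxc.mul ((continuous_const.mul φ.continuous).mul
    (continuous_partialDeriv φ i))).integrable_of_hasCompactSupport ?_
  exact (φ.hasCompactSupport.mul_left.mul_right).mul_left

/-- Integration by parts of `φ²` against `xᵢ`, whose `i`-th derivative is `1`. Compact support
removes boundary terms, so `∂Ω` needs no regularity. -/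
theorem integral_sq_testFunction (φ : 𝓓(Ω, ℝ)) (i : Fin n) :
    ∫ x, φ x ^ 2 ∂(vol Ω) = - ∫ x, x i * (2 * φ x * partialDeriv φ i x) ∂(vol Ω) := by
  have hd : Differentiable ℝ φ := φ.contDiff.differentiable (by simp)
  let π : EuclideanSpace ℝ (Fin n) →L[ℝ] ℝ := EuclideanSpace.proj i
  have hf : ∀ x, fderiv ℝ (fun x : EuclideanSpace ℝ (Fin n) => x i) x
      (EuclideanSpace.single i 1) = 1 := by
    intro x
    have : fderiv ℝ (fun x : EuclideanSpace ℝ (Fin n) => x i) x = π := π.fderiv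
    rw [this]
    simp [π]
  have hg : ∀ x, fderiv ℝ (fun x => φ x ^ 2) x (EuclideanSpace.single i 1)
      = 2 * φ x * partialDeriv φ i x := by
    intro x
    have := ((hd x).hasFDerivAt.pow 2).fderiv
    rw [this]
    simp [partialDeriv]
  have hcs : HasCompactSupport fun x => φ x ^ 2 := by
    simp only [sq]
    exact φ.hasCompactSupport.mul_right (f' := φ)
  have hxc : Continuous fun x : EuclideanSpace ℝ (Fin n) => x i := π.continuous
  have key := integral_mul_fderiv_eq_neg_fderiv_mul_of_integrable
    (μ := (volume : Measure (EuclideanSpace ℝ (Fin n))))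
    (f := fun x : EuclideanSpace ℝ (Fin n) => x i) (g := fun x => φ x ^ 2)
    (v := EuclideanSpace.single i 1) ?_ ?_ ?_ (fun x _ => π.differentiableAt)
    (fun x _ => (hd x).pow 2)
  · simp only [hf, hg, one_mul] at key
    rw [setIntegral_eq_integral_of_forall_compl_eq_zero fun x hx => by
        rw [testFunction_eq_zero φ hx]; simp,
      setIntegral_eq_integral_of_forall_compl_eq_zero fun x hx => by
        rw [testFunction_eq_zero φ hx]; simp, key, neg_neg]
  · simp only [hf, one_mul]
    exact (φ.continuous.pow 2).integrable_of_hasCompactSupport hcs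
  · simp only [hg]
    exact integrable_coord_mul φ i
  · exact (hxc.mul (φ.continuous.pow 2)).integrable_of_hasCompactSupport hcs.mul_left

theorem norm_sq_toLp_eq {f : EuclideanSpace ℝ (Fin n) → ℝ} (hf : MemLp f 2 (vol Ω)) :
    ‖hf.toLp f‖ ^ 2 = ∫ x, f x ^ 2 ∂(vol Ω) := by
  rw [← integral_sq_eq]
  refine integral_congr_ae ?_
  filter_upwards [hf.coeFn_toLp] with x hx
  rw [hx]

/-- The Poincaré inequality on `H¹₀(Ω)` for `Ω` contained in the slab `|xᵢ| ≤ R`. -/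
theorem poincare {R : ℝ} {i : Fin n}
    (hR : ∀ x ∈ (Ω : Set (EuclideanSpace ℝ (Fin n))), |x i| ≤ R) (y : H10 Ω) :
    ‖H10.val y‖ ^ 2 ≤ 4 * R ^ 2 * ‖H10.deriv y i‖ ^ 2 := by
  refine H10.mem_of_isClosed y (s := {w : Jet Ω | ‖w.fst‖ ^ 2 ≤ 4 * R ^ 2 * ‖w.snd i‖ ^ 2})
    (isClosed_le (by fun_prop) (by fun_prop)) fun φ => ?_
  change ‖(memLp_testFunction φ).toLp φ‖ ^ 2
    ≤ 4 * R ^ 2 * ‖(memLp_partialDeriv φ i).toLp (partialDeriv φ i)‖ ^ 2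
  rw [norm_sq_toLp_eq, norm_sq_toLp_eq]
  have hφ : Integrable (fun x => φ x ^ 2) (vol Ω) := (memLp_testFunction φ).integrable_sq
  have hdφ : Integrable (fun x => partialDeriv φ i x ^ 2) (vol Ω) :=
    (memLp_partialDeriv φ i).integrable_sq
  have hle : - ∫ x, x i * (2 * φ x * partialDeriv φ i x) ∂(vol Ω)
      ≤ ∫ x, (1 / 2 * φ x ^ 2 + 2 * R ^ 2 * partialDeriv φ i x ^ 2) ∂(vol Ω) := by
    rw [← integral_neg]
    refine integral_mono_ae (integrable_coord_mul φ i).neg.restrict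
      ((hφ.const_mul _).add (hdφ.const_mul _)) ?_
    filter_upwards [ae_restrict_mem Ω.isOpen.measurableSet] with x hx
    have hx2 : x i ^ 2 ≤ R ^ 2 := sq_le_sq.mpr ((hR x hx).trans (le_abs_self R))
    change - (x i * (2 * φ x * partialDeriv φ i x))
      ≤ 1 / 2 * φ x ^ 2 + 2 * R ^ 2 * partialDeriv φ i x ^ 2
    -- Young's inequality, weighted so that `½ φ²` can be absorbed on the left; doubling the
    -- remaining `2R²` gives the constant `4R²`.
    nlinarith [sq_nonneg (φ x + 2 * (x i * partialDeriv φ i x)),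
      mul_le_mul_of_nonneg_right hx2 (sq_nonneg (partialDeriv φ i x))]
  rw [← integral_sq_testFunction, integral_add (hφ.const_mul _) (hdφ.const_mul _),
    integral_const_mul, integral_const_mul] at hle
  linarith

/-! ### Coercivity and solvability by Lax–Milgram. -/

variable {A : EuclideanSpace ℝ (Fin n) → Matrix (Fin n) (Fin n) ℝ}
  {c₀ : EuclideanSpace ℝ (Fin n) → ℝ}

theorem isCoercive_bilinL (hn : 0 < n)
    (hΩ : Bornology.IsBounded (Ω : Set (EuclideanSpace ℝ (Fin n))))
    (hA : UniformlyElliptic Ω A c₀) : IsCoercive (bilinL hA) := by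
  obtain ⟨θ, hθ, hle⟩ := exists_le_bilinForm_self hA
  obtain ⟨R, hR⟩ := hΩ.exists_norm_le
  let i : Fin n := ⟨0, hn⟩
  have hP := poincare (Ω := Ω) (R := R) (i := i)
    fun x hx => (PiLp.norm_apply_le x i).trans (hR x hx)
  -- Poincaré bounds the full squared norm by `4R² + 1` times the squared gradient norm.
  refine ⟨θ / (4 * R ^ 2 + 1), by positivity, fun y => ?_⟩
  rw [bilinL_apply, mul_assoc, ← sq, div_mul_eq_mul_div, div_le_iff₀ (by positivity), H10.norm_sq]
  have h1 : ‖H10.deriv y i‖ ^ 2 ≤ ∑ j, ‖H10.deriv y j‖ ^ 2 :=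
    Finset.single_le_sum (f := fun j => ‖H10.deriv y j‖ ^ 2) (fun j _ => sq_nonneg _)
      (Finset.mem_univ i)
  have h2 : ‖H10.val y‖ ^ 2 ≤ 4 * R ^ 2 * ∑ j, ‖H10.deriv y j‖ ^ 2 :=
    (hP y).trans (by gcongr)
  calc θ * (‖H10.val y‖ ^ 2 + ∑ j, ‖H10.deriv y j‖ ^ 2)
      ≤ θ * (4 * R ^ 2 * ∑ j, ‖H10.deriv y j‖ ^ 2 + ∑ j, ‖H10.deriv y j‖ ^ 2) := by gcongr
    _ = θ * ∑ j, ‖H10.deriv y j‖ ^ 2 * (4 * R ^ 2 + 1) := by rw [← Finset.sum_mul]; ring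
    _ ≤ bilinForm A c₀ y y * (4 * R ^ 2 + 1) := by
      rw [← Finset.sum_mul, ← mul_assoc]
      gcongr
      exact hle y

theorem exists_forall_eq_of_isCoercive {V : Type*} [NormedAddCommGroup V]
    [InnerProductSpace ℝ V] [CompleteSpace V] {B : V →L[ℝ] V →L[ℝ] ℝ} (hB : IsCoercive B)
    (ℓ : V →L[ℝ] ℝ) : ∃ y, ∀ v, B y v = ℓ v := by
  obtain ⟨g, hg⟩ := (InnerProductSpace.toDual ℝ V).surjective ℓ
  obtain ⟨y, hy⟩ := hB.continuousLinearEquivOfBilin.surjective g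
  refine ⟨y, fun v => ?_⟩
  rw [← hB.continuousLinearEquivOfBilin_apply, hy, ← hg, InnerProductSpace.toDual_apply_apply]

theorem exists_isWeakSolution (hn : 0 < n)
    (hΩ : Bornology.IsBounded (Ω : Set (EuclideanSpace ℝ (Fin n))))
    (hA : UniformlyElliptic Ω A c₀) (f : L2 Ω) : ∃ y : H10 Ω, IsWeakSolution A c₀ y f := by
  have key : ∀ B : H10 Ω →L[ℝ] H10 Ω →L[ℝ] ℝ, IsCoercive B → ∀ ℓ : H10 Ω →L[ℝ] ℝ,
      ∃ y, ∀ v, B y v = ℓ v := fun B hB ℓ => exists_forall_eq_of_isCoercive (V := H10 Ω) hB ℓ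
  obtain ⟨y, hy⟩ := key (bilinL hA) (isCoercive_bilinL hn hΩ hA) ((innerSL ℝ f).comp H10.valL)
  exact ⟨y, fun v => (bilinL_apply hA y v).symm.trans (hy v)⟩

/-! ### Lipschitz functions of H¹₀ functions. -/

theorem abs_lineDeriv_comp_le {E : Type*} [NormedAddCommGroup E] [NormedSpace ℝ E]
    {F : ℝ → ℝ} {L : NNReal} (hF : LipschitzWith L F) {f : E → ℝ} {x v : E}
    (hf : LineDifferentiableAt ℝ f x v) :
    |lineDeriv ℝ (F ∘ f) x v| ≤ L * |lineDeriv ℝ f x v| := by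
  by_cases h : LineDifferentiableAt ℝ (F ∘ f) x v
  · have h1 := (h.hasLineDerivAt.tendsto_slope_zero_right).abs
    have h2 := ((hf.hasLineDerivAt.tendsto_slope_zero_right).abs).const_mul (L : ℝ)
    refine le_of_tendsto_of_tendsto' h1 h2 fun t => ?_
    rw [smul_eq_mul, smul_eq_mul, abs_mul, abs_mul, mul_left_comm]
    gcongr
    exact hF.dist_le_mul _ _
  -- Where the composite has no line derivative, `lineDeriv` is `0` by convention and the bound is
  -- trivial.
  · rw [lineDeriv_zero_of_not_lineDifferentiableAt h, abs_zero]
    positivity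

/-- `F ∘ φ` is Lipschitz, so the derivative can be moved off `ψ`. The bound sees `φ` only through
the L² norm of `∂ᵢφ`, hence survives the passage from test functions to H¹₀. -/
theorem abs_integral_comp_mul_partialDeriv_le {F : ℝ → ℝ} {L : NNReal} (hF : LipschitzWith L F)
    (φ ψ : 𝓓(Ω, ℝ)) (i : Fin n) :
    |∫ x, F (φ x) * partialDeriv ψ i x ∂(vol Ω)|
      ≤ L * ‖(memLp_partialDeriv φ i).toLp (partialDeriv φ i)‖
        * ‖(memLp_testFunction ψ).toLp ψ‖ := by
  have hline : ∀ (χ : 𝓓(Ω, ℝ)) x, HasLineDerivAt ℝ χ (partialDeriv χ i x) x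
      (EuclideanSpace.single i 1) := fun χ x =>
    (χ.contDiff.differentiable (by simp) x).hasFDerivAt.hasLineDerivAt _
  have hlip : ∀ χ : 𝓓(Ω, ℝ), ∃ C, LipschitzWith C χ := fun χ =>
    χ.contDiff.lipschitzWith_of_hasCompactSupport χ.hasCompactSupport (by simp)
  obtain ⟨C, hC⟩ := hlip φ
  obtain ⟨D, hD⟩ := hlip ψ
  let d : EuclideanSpace ℝ (Fin n) → ℝ :=
    fun x => lineDeriv ℝ (F ∘ φ) x (EuclideanSpace.single i 1)
  have hle : ∀ x, ‖d x‖ ≤ L * ‖partialDeriv φ i x‖ := fun x => by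
    have := abs_lineDeriv_comp_le hF (hline φ x).lineDifferentiableAt
    rwa [(hline φ x).lineDeriv] at this
  have hd : MemLp d 2 (vol Ω) :=
    (memLp_partialDeriv φ i).of_le_mul
      (measurable_lineDeriv (hF.continuous.comp φ.continuous)).aestronglyMeasurable
      (.of_forall hle)
  have hparts := (hF.comp hC).integral_lineDeriv_mul_eq (μ := volume) hD ψ.hasCompactSupport
    (EuclideanSpace.single i 1)
  have e : ∫ x, F (φ x) * partialDeriv ψ i x ∂(vol Ω)
      = - inner ℝ (hd.toLp d) ((memLp_testFunction ψ).toLp ψ) := by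
    have e1 : inner ℝ (hd.toLp d) ((memLp_testFunction ψ).toLp ψ) = ∫ x, d x * ψ x ∂(vol Ω) := by
      rw [inner_toLp_right]
      refine integral_congr_ae ?_
      filter_upwards [hd.coeFn_toLp] with x hx
      rw [hx]
    rw [e1, setIntegral_eq_integral_of_forall_compl_eq_zero fun x hx => by
        rw [partialDeriv_eq_zero ψ i hx, mul_zero],
      setIntegral_eq_integral_of_forall_compl_eq_zero fun x hx => by
        rw [testFunction_eq_zero ψ hx, mul_zero], hparts, ← integral_neg]
    refine integral_congr_ae (.of_forall fun x => ?_)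
    simp only [lineDeriv_neg, (hline ψ x).lineDeriv, Function.comp_apply]
    ring
  rw [e, abs_neg]
  refine (abs_real_inner_le_norm _ _).trans ?_
  gcongr
  refine Lp.norm_le_mul_norm_of_ae_le_mul ?_
  filter_upwards [hd.coeFn_toLp, (memLp_partialDeriv φ i).coeFn_toLp] with x h1 h2
  rw [h1, h2]
  exact hle x

/-- A functional on test functions that is bounded for the `L²`-norm is represented in `L²`. -/
theorem exists_inner_eq_of_bound (ℓ : 𝓓(Ω, ℝ) →ₗ[ℝ] ℝ) (C : ℝ)
    (hℓ : ∀ ψ, |ℓ ψ| ≤ C * ‖(memLp_testFunction ψ).toLp ψ‖) :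
    ∃ g : L2 Ω, ∀ ψ, ℓ ψ = inner ℝ g ((memLp_testFunction ψ).toLp ψ) := by
  let T : 𝓓(Ω, ℝ) →ₗ[ℝ] L2 Ω :=
    (WithLp.fstL 2 ℝ (L2 Ω) (PiLp 2 fun _ : Fin n => L2 Ω)).toLinearMap.comp testJetₗ
  have hT : ∀ ψ, T ψ = (memLp_testFunction ψ).toLp ψ := fun ψ => rfl
  -- The bound makes `ℓ` vanish on the kernel of `T`, so `ℓ` factors through `T`.
  have hmem : ℓ ∈ LinearMap.range T.dualMap := by
    rw [LinearMap.range_dualMap_eq_dualAnnihilator_ker, Submodule.mem_dualAnnihilator]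
    intro ψ hψ
    have := hℓ ψ
    rw [← hT, LinearMap.mem_ker.mp hψ, norm_zero, mul_zero] at this
    exact abs_nonpos_iff.mp this
  obtain ⟨m, hm⟩ := hmem
  have hm' : ∀ ψ, m (T ψ) = ℓ ψ := fun ψ => by rw [← hm]; rfl
  -- `m` is merely an algebraic functional on L², with a bound known only on the range of `T`. It is
  -- restricted there and extended by Hahn–Banach.
  obtain ⟨G, hG, -⟩ := _root_.exists_extension_norm_eq (LinearMap.range T)
    ((m.domRestrict (LinearMap.range T)).mkContinuous C (by
      rintro ⟨_, ψ, rfl⟩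
      change |m (T ψ)| ≤ C * ‖T ψ‖
      rw [hm', hT]
      exact hℓ ψ))
  refine ⟨(InnerProductSpace.toDual ℝ (L2 Ω)).symm G, fun ψ => ?_⟩
  rw [InnerProductSpace.toDual_symm_apply, ← hT, ← hm']
  exact (hG ⟨T ψ, ψ, rfl⟩).symm

theorem memH1_of_bound (u : L2 Ω) (C : Fin n → ℝ)
    (h : ∀ (ψ : 𝓓(Ω, ℝ)) (i : Fin n), |∫ x, u x * partialDeriv ψ i x ∂(vol Ω)|
      ≤ C i * ‖(memLp_testFunction ψ).toLp ψ‖) : MemH1 u := by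
  let ℓ : Fin n → 𝓓(Ω, ℝ) →ₗ[ℝ] ℝ := fun i =>
    (((innerSL ℝ u).comp (PiLp.proj 2 (fun _ : Fin n => L2 Ω) i)).comp
      (WithLp.sndL 2 ℝ (L2 Ω) (PiLp 2 fun _ : Fin n => L2 Ω))).toLinearMap.comp testJetₗ
  have hℓ : ∀ i ψ, ℓ i ψ = ∫ x, u x * partialDeriv ψ i x ∂(vol Ω) := fun i ψ =>
    inner_toLp_right u (memLp_partialDeriv ψ i)
  choose g hg using fun i => exists_inner_eq_of_bound (ℓ i) (C i) fun ψ => by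
    rw [hℓ]
    exact h ψ i
  refine ⟨WithLp.toLp 2 (u, WithLp.toLp 2 fun i => - g i), fun ψ i => ?_, rfl⟩
  change ∫ x, u x * partialDeriv ψ i x ∂(vol Ω) = - ∫ x, (- g i : L2 Ω) x * ψ x ∂(vol Ω)
  rw [← hℓ, hg, ← inner_toLp_right (- g i) (memLp_testFunction ψ), inner_neg_left, neg_neg]

/-- Lipschitz functions vanishing at `0` map `H¹₀(Ω)` into `H¹(Ω)`. -/
theorem memH1_compLp {F : ℝ → ℝ} {L : NNReal} (hF : LipschitzWith L F) (F0 : F 0 = 0)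
    (y : H10 Ω) : MemH1 (hF.compLp F0 (H10.val y)) := by
  refine memH1_of_bound _ (fun i => L * ‖H10.deriv y i‖) fun ψ i => ?_
  have hc := hF.continuous_compLp (p := 2) (μ := vol Ω) F0
  rw [← inner_toLp_right _ (memLp_partialDeriv ψ i)]
  refine H10.mem_of_isClosed y (s := {w : Jet Ω |
    |inner ℝ (hF.compLp F0 w.fst) ((memLp_partialDeriv ψ i).toLp (partialDeriv ψ i))|
      ≤ L * ‖w.snd i‖ * ‖(memLp_testFunction ψ).toLp ψ‖})
    (isClosed_le (by fun_prop) (by fun_prop)) fun φ => ?_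
  refine le_trans (le_of_eq ?_) (abs_integral_comp_mul_partialDeriv_le hF φ ψ i)
  rw [inner_toLp_right]
  congr 1
  refine integral_congr_ae ?_
  filter_upwards [hF.coeFn_compLp F0 (testJet φ).fst, (memLp_testFunction φ).coeFn_toLp]
    with x h1 h2
  rw [h1, Function.comp_apply]
  exact congrArg (fun t => F t * _) h2

end Sobolev

/-! ### Soft thresholding and projection on the real line. -/

section Optimality

/-- This form avoids the discontinuous sign, so Lipschitz continuity can be read off. -/
theorem soft_eq {β : ℝ} (hβ : 0 < β) (t : ℝ) : soft t β = max (t - β) 0 + min (t + β) 0 := by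
  unfold soft
  rcases lt_trichotomy t 0 with h | h | h
  · rw [Real.sign_of_neg h, abs_of_neg h, max_eq_right (by linarith : t - β ≤ 0)]
    rcases le_total (-t - β) 0 with h' | h'
    · rw [max_eq_right h', min_eq_right (by linarith)]
      ring
    · rw [max_eq_left h', min_eq_left (by linarith)]
      ring
  · subst h
    simp [hβ.le]
  · rw [Real.sign_of_pos h, abs_of_pos h, min_eq_right (by linarith : 0 ≤ t + β)]
    ring

theorem exists_lipschitzWith_proj_soft (a b α : ℝ) {β : ℝ} (hβ : 0 < β) :
    ∃ L, LipschitzWith L fun t => proj a b (1 / α * soft t β) := by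
  have h1 : LipschitzWith (1 + 0) fun t : ℝ => t - β := LipschitzWith.id.sub (.const β)
  have h2 : LipschitzWith (1 + 0) fun t : ℝ => t + β := LipschitzWith.id.add (.const β)
  have h3 := (h1.max_const 0).add (h2.min_const 0)
  simp only [← soft_eq hβ] at h3
  have h4 := (lipschitzWith_smul (1 / α : ℝ)).comp h3
  exact ⟨_, (h4.min_const b).const_max a⟩

theorem proj_soft_zero {a b : ℝ} (α β : ℝ) (ha : a < 0) (hb : 0 < b) :
    proj a b (1 / α * soft 0 β) = 0 := by
  simp [proj, soft, ha.le, hb.le]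

theorem proj_mem {a b : ℝ} (hab : a ≤ b) (t : ℝ) : a ≤ proj a b t ∧ proj a b t ≤ b :=
  ⟨le_max_left _ _, max_le hab (min_le_right _ _)⟩

theorem proj_variational {a b : ℝ} (q : ℝ) {t : ℝ} (hat : a ≤ t) (htb : t ≤ b) :
    0 ≤ (proj a b q - q) * (t - proj a b q) := by
  unfold proj
  rcases le_total q b with h | h
  · rw [min_eq_left h]
    rcases le_total a q with h' | h'
    · rw [max_eq_right h', sub_self, zero_mul]
    · rw [max_eq_left h']
      exact mul_nonneg (by linarith) (by linarith)
  · rw [min_eq_right h, max_eq_right (hat.trans htb)]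
    exact mul_nonneg_of_nonpos_of_nonpos (by linarith) (by linarith)

/-- The number `proj a b (soft p β / α)` minimizes `α/2 t² - p t + β |t|` over `[a, b]`. -/
theorem proj_soft_variational {a b α β : ℝ} (ha : a < 0) (hb : 0 < b) (hα : 0 < α) (hβ : 0 < β)
    (p : ℝ) {t : ℝ} (hat : a ≤ t) (htb : t ≤ b) :
    0 ≤ (α * proj a b (1 / α * soft p β) - p) * (t - proj a b (1 / α * soft p β))
      + β * (|t| - |proj a b (1 / α * soft p β)|) := by
  set s := soft p β with hs
  set w := proj a b (1 / α * s) with hw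
  have h1 : 0 ≤ (w - 1 / α * s) * (t - w) := proj_variational _ hat htb
  -- `p - s` is a subgradient of `β |·|` at `w`: scaling and projection cannot reverse the sign of
  -- `s`, because `a < 0 < b`.
  have h2 : |p - s| ≤ β ∧ (p - s) * w = β * |w| := by
    rw [soft_eq hβ] at hs
    rcases lt_or_ge β p with h | h
    · rw [max_eq_left (by linarith), min_eq_right (by linarith)] at hs
      have hs0 : 0 ≤ s := by linarith
      have hw0 : 0 ≤ w := le_max_of_le_right (le_min (by positivity) hb.le)
      rw [abs_of_nonneg hw0, show p - s = β by linarith, abs_of_pos hβ]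
      exact ⟨le_rfl, rfl⟩
    · rcases lt_or_ge p (-β) with h' | h'
      · rw [max_eq_right (by linarith), min_eq_left (by linarith)] at hs
        have hs0 : s ≤ 0 := by linarith
        have hw0 : w ≤ 0 := max_le ha.le
          (min_le_of_left_le (mul_nonpos_of_nonneg_of_nonpos (by positivity) hs0))
        rw [abs_of_nonpos hw0, show p - s = -β by linarith, abs_neg, abs_of_pos hβ]
        exact ⟨le_rfl, by ring⟩
      · rw [max_eq_right (by linarith), min_eq_right (by linarith), add_zero] at hs
        have hw0 : w = 0 := by simp [hw, hs, proj, ha.le, hb.le]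
        rw [hw0, hs, sub_zero]
        exact ⟨abs_le.mpr ⟨h', h⟩, by simp⟩
  have h3 : (p - s) * t ≤ β * |t| :=
    (le_abs_self _).trans ((abs_mul _ _).trans_le (by gcongr; exact h2.1))
  have h4 : α * ((w - 1 / α * s) * (t - w)) = (α * w - s) * (t - w) := by
    field_simp
  have h5 := mul_nonneg hα.le h1
  rw [h4] at h5
  linarith [h2.2]

/-! ### The optimality system and the projection formula. -/

variable {n : ℕ} {Ω : Opens (EuclideanSpace ℝ (Fin n))}
  {A : EuclideanSpace ℝ (Fin n) → Matrix (Fin n) (Fin n) ℝ} {c₀ : EuclideanSpace ℝ (Fin n) → ℝ}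

theorem isFiniteMeasure_vol (hΩ : Bornology.IsBounded (Ω : Set (EuclideanSpace ℝ (Fin n)))) :
    IsFiniteMeasure (vol Ω) :=
  ⟨by rw [Measure.restrict_apply_univ]; exact hΩ.measure_lt_top⟩

theorem integrable_abs (hΩ : Bornology.IsBounded (Ω : Set (EuclideanSpace ℝ (Fin n))))
    (f : L2 Ω) : Integrable (fun x => |f x|) (vol Ω) := by
  have := isFiniteMeasure_vol hΩ
  exact ((Lp.memLp f).integrable (by norm_num)).abs

theorem normL1_add_smul_sub_le (hΩ : Bornology.IsBounded (Ω : Set (EuclideanSpace ℝ (Fin n))))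
    (f g : L2 Ω) {t : ℝ} (h0 : 0 ≤ t) (h1 : t ≤ 1) :
    normL1 (f + t • (g - f)) ≤ normL1 f + t * (normL1 g - normL1 f) := by
  have hf := integrable_abs hΩ f
  have hg := integrable_abs hΩ g
  have e : normL1 f + t * (normL1 g - normL1 f)
      = ∫ x, ((1 - t) * |f x| + t * |g x|) ∂(vol Ω) := by
    rw [integral_add (hf.const_mul _) (hg.const_mul _), integral_const_mul, integral_const_mul]
    simp only [normL1]
    ring
  rw [e]
  refine integral_mono_ae (integrable_abs hΩ _) ((hf.const_mul _).add (hg.const_mul _)) ?_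
  filter_upwards [Lp.coeFn_add f (t • (g - f)), Lp.coeFn_smul t (g - f), Lp.coeFn_sub g f]
    with x e1 e2 e3
  rw [e1, Pi.add_apply, e2, Pi.smul_apply, e3, Pi.sub_apply, smul_eq_mul,
    show f x + t * (g x - f x) = (1 - t) * f x + t * g x by ring]
  refine (abs_add_le _ _).trans_eq ?_
  rw [abs_mul, abs_mul, abs_of_nonneg h0, abs_of_nonneg (sub_nonneg.mpr h1)]

theorem Uad_add_smul_sub {a b : ℝ} {f g : L2 Ω} (hf : f ∈ Uad Ω a b) (hg : g ∈ Uad Ω a b)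
    {t : ℝ} (h0 : 0 ≤ t) (h1 : t ≤ 1) : f + t • (g - f) ∈ Uad Ω a b := by
  change ∀ᵐ x ∂(vol Ω), _
  filter_upwards [Lp.coeFn_add f (t • (g - f)), Lp.coeFn_smul t (g - f), Lp.coeFn_sub g f, hf, hg]
    with x e1 e2 e3 hf hg
  rw [e1, Pi.add_apply, e2, Pi.smul_apply, e3, Pi.sub_apply, smul_eq_mul]
  constructor <;> nlinarith [mul_le_mul_of_nonneg_left hf.1 (sub_nonneg.mpr h1),
    mul_le_mul_of_nonneg_left hf.2 (sub_nonneg.mpr h1), mul_le_mul_of_nonneg_left hg.1 h0,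
    mul_le_mul_of_nonneg_left hg.2 h0]

theorem IsWeakSolution.add_smul_sub (hA : UniformlyElliptic Ω A c₀) {y y' : H10 Ω} {f f' : L2 Ω}
    (h : IsWeakSolution A c₀ y f) (h' : IsWeakSolution A c₀ y' f') (t : ℝ) :
    IsWeakSolution A c₀ (y + t • (y' - y)) (f + t • (f' - f)) := by
  intro v
  rw [← bilinL_apply hA, map_add, map_smul, map_sub, _root_.add_apply,
    _root_.smul_apply, _root_.sub_apply, bilinL_apply, bilinL_apply,
    h v, h' v, inner_add_left, real_inner_smul_left, inner_sub_left, smul_eq_mul]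

/-- Testing the adjoint equation with the states and the state equations with `p` eliminates the
bilinear form. -/
theorem IsAdjointSolution.inner_sub_eq {y y' p : H10 Ω} {f f' g : L2 Ω}
    (hp : IsAdjointSolution A c₀ p g) (h : IsWeakSolution A c₀ y f)
    (h' : IsWeakSolution A c₀ y' f') :
    inner ℝ g (H10.val y' - H10.val y) = inner ℝ (f' - f) (H10.val p) := by
  rw [inner_sub_right, ← hp y', ← hp y, h' p, h p, inner_sub_left]

theorem exists_isAdjointSolution (hn : 0 < n)
    (hΩ : Bornology.IsBounded (Ω : Set (EuclideanSpace ℝ (Fin n))))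
    (hA : UniformlyElliptic Ω A c₀) (f : L2 Ω) : ∃ p : H10 Ω, IsAdjointSolution A c₀ p f := by
  obtain ⟨p, hp⟩ := exists_isWeakSolution hn hΩ hA f
  exact ⟨p, fun v => (bilinForm_comm hA v p).trans (hp v)⟩

theorem norm_add_smul_sq {E : Type*} [NormedAddCommGroup E] [InnerProductSpace ℝ E]
    (x d : E) (t : ℝ) :
    ‖x + t • d‖ ^ 2 = ‖x‖ ^ 2 + 2 * t * inner ℝ x d + t ^ 2 * ‖d‖ ^ 2 := by
  rw [norm_add_sq_real, real_inner_smul_right, norm_smul, mul_pow, Real.norm_eq_abs, sq_abs]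
  ring

theorem nonneg_of_forall_mul_add_sq_nonneg {P Q : ℝ} (hQ : 0 ≤ Q)
    (h : ∀ t : ℝ, 0 < t → t ≤ 1 → 0 ≤ t * P + t ^ 2 * Q) : 0 ≤ P := by
  by_contra! hP
  -- This `t` forces `tQ ≤ -P/2`, hence `P + tQ < 0`; the `+ 1` keeps the denominator positive when
  -- `Q = 0`.
  have ht : 0 < min 1 (-P / (2 * (Q + 1))) := lt_min one_pos (div_pos (by linarith) (by linarith))
  set t := min 1 (-P / (2 * (Q + 1)))
  have h1 := h t ht (min_le_left _ _)
  have h2 : t * (2 * (Q + 1)) ≤ -P := (le_div_iff₀ (by linarith)).mp (min_le_right _ _)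
  have h3 : 0 ≤ P + t * Q := nonneg_of_mul_nonneg_right (by linarith : 0 ≤ t * (P + t * Q)) ht
  nlinarith

variable {yc yd : L2 Ω} {a b α β : ℝ} {y : H10 Ω} {u z : L2 Ω}

theorem KKT.isOptimal (hα : 0 < α) {p : H10 Ω} {lam : L2 Ω}
    (h : KKT A c₀ yc yd a b α β y u z p lam) : IsOptimal A c₀ yc yd a b α β y u z := by
  refine ⟨⟨h.state, h.control_eq, h.admissible⟩, ?_⟩
  rintro ⟨y', u', z'⟩ ⟨hy', hu' : u' = z', hz' : z' ∈ Uad Ω a b⟩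
  have hu := h.control_eq
  subst hu hu'
  have hvar := h.variational u' hz'
  have hadj := h.adjoint.inner_sub_eq h.state hy'
  have hlam : lam = H10.val p - (α / 2) • u := by
    rw [← sub_eq_zero, ← h.stationarity]
    abel
  rw [add_sub_add_right_eq_sub] at hadj
  change 1 / 2 * ‖H10.val y - yd‖ ^ 2 + α / 4 * ‖u‖ ^ 2 + α / 4 * ‖u‖ ^ 2 + β * normL1 u
    ≤ 1 / 2 * ‖H10.val y' - yd‖ ^ 2 + α / 4 * ‖u'‖ ^ 2 + α / 4 * ‖u'‖ ^ 2 + β * normL1 u'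
  have e1 : ‖H10.val y' - yd‖ ^ 2 = ‖H10.val y - yd‖ ^ 2
      + 2 * inner ℝ (H10.val y - yd) (H10.val y' - H10.val y) + ‖H10.val y' - H10.val y‖ ^ 2 := by
    rw [← norm_add_sq_real, add_comm, sub_add_sub_cancel]
  have e2 : ‖u'‖ ^ 2 = ‖u‖ ^ 2 + 2 * inner ℝ u (u' - u) + ‖u' - u‖ ^ 2 := by
    rw [← norm_add_sq_real, add_sub_cancel]
  have e3 : inner ℝ (H10.val y - yd) (H10.val y' - H10.val y)
      = - inner ℝ (H10.val p) (u' - u) := by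
    rw [← neg_sub yd, inner_neg_left, hadj, real_inner_comm]
  rw [hlam, inner_sub_left, inner_sub_left, real_inner_smul_left] at hvar
  rw [e1, e2, e3]
  -- What remains is `hvar` plus the squares `½‖y' - y‖²` and `α/2 ‖u' - u‖²`.
  nlinarith [sq_nonneg ‖H10.val y' - H10.val y‖, mul_nonneg hα.le (sq_nonneg ‖u' - u‖)]

theorem IsOptimal.exists_KKT (hn : 0 < n)
    (hΩ : Bornology.IsBounded (Ω : Set (EuclideanSpace ℝ (Fin n))))
    (hA : UniformlyElliptic Ω A c₀) (hα : 0 < α) (hβ : 0 < β)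
    (h : IsOptimal A c₀ yc yd a b α β y u z) :
    ∃ (p : H10 Ω) (lam : L2 Ω), KKT A c₀ yc yd a b α β y u z p lam := by
  obtain ⟨⟨hy, hu : u = z, hz : z ∈ Uad Ω a b⟩, hmin⟩ := h
  subst hu
  change IsWeakSolution A c₀ y (u + yc) at hy
  obtain ⟨p, hp⟩ := exists_isAdjointSolution hn hΩ hA (yd - H10.val y)
  -- Stationarity leaves no other choice of multiplier.
  refine ⟨p, H10.val p - (α / 2) • u, hy, hp, by abel, rfl, hz, fun zt hzt => ?_⟩
  obtain ⟨yt, hyt⟩ := exists_isWeakSolution hn hΩ hA (zt + yc)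
  have hadj := hp.inner_sub_eq hy hyt
  rw [add_sub_add_right_eq_sub, ← neg_sub (H10.val y), inner_neg_left,
    real_inner_comm (H10.val p)] at hadj
  set d := H10.val yt - H10.val y
  -- `Q` is the exact second-order coefficient of the cost along the segment; the two `α/4` terms
  -- merge since `u = z`.
  refine nonneg_of_forall_mul_add_sq_nonneg
    (Q := 1 / 2 * ‖d‖ ^ 2 + α / 2 * ‖zt - u‖ ^ 2) (by positivity) fun t h0 h1 => ?_
  have hfeas : (y + t • (yt - y), u + t • (zt - u), u + t • (zt - u)) ∈ feasible A c₀ yc a b := by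
    refine ⟨?_, rfl, Uad_add_smul_sub hz hzt h0.le h1⟩
    have := hy.add_smul_sub hA hyt t
    rw [add_sub_add_right_eq_sub, add_right_comm] at this
    exact this
  have hle : cost yd α β (y, u, u)
      ≤ cost yd α β (y + t • (yt - y), u + t • (zt - u), u + t • (zt - u)) := hmin hfeas
  have e1 : H10.val (y + t • (yt - y)) - yd = (H10.val y - yd) + t • d := by
    rw [← H10.valL_apply, map_add, map_smul, map_sub, H10.valL_apply, H10.valL_apply]
    abel
  simp only [cost] at hle
  rw [e1, norm_add_smul_sq, norm_add_smul_sq] at hle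
  have hN := mul_le_mul_of_nonneg_left (normL1_add_smul_sub_le hΩ u zt h0.le h1) hβ.le
  have e2 : inner ℝ ((α / 2) • u - (H10.val p - (α / 2) • u)) (zt - u)
      = α * inner ℝ u (zt - u) + inner ℝ (H10.val y - yd) d := by
    rw [inner_sub_left, inner_sub_left, real_inner_smul_left]
    linarith
  rw [e2]
  nlinarith

/-- No pointwise localization of the inequality for `u` is needed. It is tested with `w`, the
integrated scalar inequality for `w` is tested with `u`, and their sum leaves `-α‖u - w‖² ≥ 0`. -/
theorem KKT.control_eq_compLp (hΩ : Bornology.IsBounded (Ω : Set (EuclideanSpace ℝ (Fin n))))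
    (ha : a < 0) (hb : 0 < b) (hα : 0 < α) (hβ : 0 < β) {p : H10 Ω} {lam : L2 Ω}
    (h : KKT A c₀ yc yd a b α β y u z p lam) {L : NNReal}
    (hL : LipschitzWith L fun t => proj a b (1 / α * soft t β)) :
    u = hL.compLp (proj_soft_zero α β ha hb) (H10.val p) := by
  have hu := h.control_eq
  subst hu
  set w := hL.compLp (proj_soft_zero α β ha hb) (H10.val p)
  have hwx : ∀ᵐ x ∂(vol Ω), w x = proj a b (1 / α * soft (H10.val p x) β) :=
    hL.coeFn_compLp (proj_soft_zero α β ha hb) (H10.val p)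
  have hmem : w ∈ Uad Ω a b := by
    change ∀ᵐ x ∂(vol Ω), _
    filter_upwards [hwx] with x hx
    rw [hx]
    exact proj_mem (ha.trans hb).le _
  have hlam : lam = H10.val p - (α / 2) • u := by
    rw [← sub_eq_zero, ← h.stationarity]
    abel
  have h1 := h.variational w hmem
  have h2 : 0 ≤ inner ℝ (α • w - H10.val p) (u - w) + β * (normL1 u - normL1 w) := by
    have hi : Integrable (fun x => (α • w - H10.val p : L2 Ω) x * (u - w : L2 Ω) x) (vol Ω) :=
      integrable_mul_of_memLp (Lp.memLp _) (Lp.memLp _)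
    have hab : Integrable (fun x => |u x| - |w x|) (vol Ω) :=
      (integrable_abs hΩ u).sub (integrable_abs hΩ w)
    rw [inner_eq_integral, normL1, normL1, ← integral_sub (integrable_abs hΩ u)
      (integrable_abs hΩ w), ← integral_const_mul, ← integral_add hi (hab.const_mul β)]
    refine integral_nonneg_of_ae ?_
    filter_upwards [hwx, h.admissible, Lp.coeFn_sub (α • w) (H10.val p), Lp.coeFn_smul α w,
      Lp.coeFn_sub u w] with x e1 e2 e3 e4 e5
    rw [e3, e5, Pi.sub_apply, Pi.sub_apply, e4, Pi.smul_apply, smul_eq_mul, e1]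
    exact proj_soft_variational ha hb hα hβ _ e2.1 e2.2
  have e1 : inner ℝ ((α / 2) • u - lam) (w - u) + inner ℝ (α • w - H10.val p) (u - w)
      = - (α * ‖u - w‖ ^ 2) := by
    rw [← neg_sub u w, inner_neg_right, neg_add_eq_sub, ← inner_sub_left,
      ← real_inner_self_eq_norm_sq, ← real_inner_smul_left, ← inner_neg_left, hlam]
    congr 1
    module
  have h3 : α * ‖u - w‖ ^ 2 ≤ 0 := by linarith
  have h4 : ‖u - w‖ ^ 2 = 0 :=
    le_antisymm (nonpos_of_mul_nonpos_right h3 hα) (sq_nonneg _)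
  exact sub_eq_zero.mp (norm_eq_zero.mp (pow_eq_zero_iff two_ne_zero |>.mp h4))

end Optimality

end SparseControl

end

theorem theorem2p2 {n : ℕ} (hn : 0 < n)
    (Ω : TopologicalSpace.Opens (EuclideanSpace ℝ (Fin n)))
    (hΩ : Bornology.IsBounded (Ω : Set (EuclideanSpace ℝ (Fin n))))
    (A : EuclideanSpace ℝ (Fin n) → Matrix (Fin n) (Fin n) ℝ)
    (c₀ : EuclideanSpace ℝ (Fin n) → ℝ)
    (hA : SparseControl.UniformlyElliptic Ω A c₀)
    (yc yd : SparseControl.L2 Ω) (a b α β : ℝ)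
    (ha : a < 0) (hb : 0 < b) (hα : 0 < α) (hβ : 0 < β)
    (y : SparseControl.H10 Ω) (u z : SparseControl.L2 Ω) :
    (SparseControl.IsOptimal A c₀ yc yd a b α β y u z ↔
      ∃ (p : SparseControl.H10 Ω) (lam : SparseControl.L2 Ω),
        SparseControl.KKT A c₀ yc yd a b α β y u z p lam) ∧
    (∀ (p : SparseControl.H10 Ω) (lam : SparseControl.L2 Ω),
      SparseControl.KKT A c₀ yc yd a b α β y u z p lam →
        ∀ᵐ x ∂(SparseControl.vol Ω), u x =
          SparseControl.proj a b (1 / α * SparseControl.soft (SparseControl.H10.val p x) β)) ∧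
    (SparseControl.IsOptimal A c₀ yc yd a b α β y u z → SparseControl.MemH1 u) := by
  obtain ⟨L, hL⟩ := SparseControl.exists_lipschitzWith_proj_soft a b α hβ
  have h0 := SparseControl.proj_soft_zero α β ha hb
  refine ⟨⟨fun h => h.exists_KKT hn hΩ hA hα hβ, ?_⟩, fun p lam h => ?_, fun h => ?_⟩
  · rintro ⟨p, lam, h⟩
    exact h.isOptimal hα
  · rw [h.control_eq_compLp hΩ ha hb hα hβ hL]
    exact hL.coeFn_compLp h0 _
  · obtain ⟨p, lam, hK⟩ := h.exists_KKT hn hΩ hA hα hβ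
    rw [hK.control_eq_compLp hΩ ha hb hα hβ hL]
    exact SparseControl.memH1_compLp hL h0 p
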